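/- Fix a prime $p$ and integers $K\ge 1$, $d\ge 1$. A linear computation broadcast (LCBC) instance with $K$ users, data dimension $d$ and one-dimensional demands and side-information ($m=m'=1$) over $\mathbb F_q$ consists of vectors $v_k,v_k'\in\mathbb F_q^{d}$, $k=1,\dots,K$. A coding scheme consists of a batch size $L\ge 1$, a finite alphabet $\mathcal S$, an encoder $\Phi$ mapping the data $x\in\mathbb F_q^{d\times L}$ to $\Phi(x)\in\mathcal S$, and decoders $\Psi_k:\mathcal S\times\mathbb F_q^{L}\to\mathbb F_q^{L}$ (none of the maps need be linear); it is achievable if $\Psi_k(\Phi(x),x^{T}v_k')=x^{T}v_k$ for all $k$ and all $x$. Its cost is $\log_q|\mathcal S|/L$, and the optimal broadcast cost $\Delta^*$ of the instance is the infimum of the costs of all achievable schemes. Let $\Lambda_n$ be uniformly random among all such instances over $\mathbb F_{p^n}$. The generic optimal broadcast cost $\Delta_g$ is the number to which $\Delta^*(\Lambda_n)$ converges in probability as $n\to\infty$, if there is one; that is, $\lim_{n\to\infty}\Pr(|\Delta^*(\Lambda_n)-\Delta_g|<\varepsilon)=1$ for every $\varepsilon>0$. Theorem. For all $p$, $K$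 and $d$, the generic optimal broadcast cost exists and is given as follows. 1. For even $d$: $\Delta_g=d/2$ if $2\le d\le 2K$, and $\Delta_g=K$ if $d\ge 2K$. 2. For odd $d$: $\Delta_g=0$ if $d=1$; $\Delta_g=d/2$ if $3\le d<2K-1$; $\Delta_g=K-1$ if $d=2K-1$; and $\Delta_g=K$ if $d>2K-1$. -/

import Mathlib

open Filter Topology

noncomputable section

/-- An instance of linear computation broadcast over the field `F` with `K` users and data
dimension `d`. User `k` has side information `xᵀ * v' k` (of dimension `m' k`) and demands
`xᵀ * v k` (of dimension `m k`), where `x` is the data. -/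
@[ext]
structure LCBC (F : Type) (K d : ℕ) (m m' : Fin K → ℕ) where
  /-- demand coefficient matrices -/
  v : ∀ k, Matrix (Fin d) (Fin (m k)) F
  /-- side-information coefficient matrices -/
  v' : ∀ k, Matrix (Fin d) (Fin (m' k)) F

namespace LCBC

variable {F : Type} [Field F] {K d : ℕ} {m m' : Fin K → ℕ}

/-- An achievable coding scheme: a batch size `L ≥ 1`, a finite broadcast alphabet, an arbitrary
(not necessarily linear) encoder and arbitrary decoders, such that every user recovers its demand
for every realization of the data `x`, whose columns are the `L` data instances. -/
structure AchievableScheme (Λ : LCBC F K d m m') where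
  L : ℕ
  one_le_L : 1 ≤ L
  Alphabet : Type
  finite_alphabet : Finite Alphabet
  enc : Matrix (Fin d) (Fin L) F → Alphabet
  dec : ∀ k, Alphabet → Matrix (Fin L) (Fin (m' k)) F → Matrix (Fin L) (Fin (m k)) F
  decodes : ∀ (x : Matrix (Fin d) (Fin L) F) (k : Fin K),
    dec k (enc x) (x.transpose * Λ.v' k) = x.transpose * Λ.v k

/-- The broadcast cost `log_q |S| / L` of a scheme, where `q = |F|`. -/
def AchievableScheme.cost {Λ : LCBC F K d m m'} (σ : Λ.AchievableScheme) : ℝ :=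
  Real.logb (Nat.card F) (Nat.card σ.Alphabet) / σ.L

/-- The optimal broadcast cost: the infimum of the costs of all achievable schemes. -/
def optimalCost (Λ : LCBC F K d m m') : ℝ :=
  sInf (Set.range fun σ : Λ.AchievableScheme => σ.cost)

/-- The probability of an event when the instance is drawn uniformly at random among all instances
over `F` with the given dimensions. -/
def prob (F : Type) (K d : ℕ) (m m' : Fin K → ℕ) (E : Set (LCBC F K d m m')) : ℝ :=
  (E.ncard : ℝ) / (Nat.card (LCBC F K d m m') : ℝ)

/-- `Δ` is the generic optimal broadcast cost for the parameters `p, K, d, m, m'`: the optimal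
broadcast cost of a uniformly random instance over the field with `p ^ n` elements converges to
`Δ` in probability as `n → ∞`. -/
def IsGenericOptimalCost (p : ℕ) [Fact p.Prime] (K d : ℕ) (m m' : Fin K → ℕ) (Δ : ℝ) : Prop :=
  ∀ ε : ℝ, 0 < ε →
    Tendsto (fun n : ℕ => prob (GaloisField p n) K d m m' {Λ | |Λ.optimalCost - Δ| < ε})
      atTop (𝓝 1)

end LCBC

end

/-! Converse. If `t` users have `2t` independent vectors, some data make all their side information
vanish while their demands are arbitrary, so the cost is at least `t` (`natCast_le_optimalCost`).
This settles even `d`, `d ≥ 2K` and `d = 2K - 1`. For odd `d = 2s + 3 < 2K - 1` the bound `d/2`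
comes from submodularity. Take `s` users `e i` and three more, A, B, C. The broadcast with the side
information of the `e i` and A, or of the `e i` and B, determines the planes of the users involved.
Both determine the planes of the `e i` and the line `ell` where the plane of A meets the span of the
planes of the `e i` and B; jointly they determine the data, and so does their common part together
with the side information of C. `card_sq_le_of_common_function` turns this into a count valid for
arbitrary encoders.

Achievability of `d/2` is interference alignment over the prime field, with `F` regarded as an
`n`-dimensional `ZMod p`-space. Each user forms two random combinations of its demand and
side-information vectors. With `τ` the number of resulting coordinates `t y`, take `2 N ^ τ ≈ n` and
broadcast `lam (m * z i)` for every data coordinate `z i` and every monomial `m` in the `t y` with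
exponents at most `N`, where `lam` is a nonzero functional `F → ZMod p`. This is `d (N + 1) ^ τ ≈ d
n / 2` prime-field symbols. Multiplying a monomial with exponents below `N` by one `t y` stays in
the family, so each user obtains `2 N ^ τ` functionals of its demand. Generically these are
independent; the few missing ones are sent separately (`Alignable.optimalCost_le`).

The remaining upper bounds are direct: sending all demands costs `K`; for `d = 1` a nonzero
side-information scalar reveals the data; for `d = 2K - 1` the single linear relation among the `2K`
vectors saves one symbol.

Genericity is Schwartz–Zippel for polynomials over the prime field. In the alignment their number
and degrees grow with `n`, so a quantitative union bound is needed. -/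

noncomputable section

/-! ### Counting zeros of polynomials over finite fields -/

namespace MvPolynomial

theorem card_zeros_mul_card_le {σ F : Type*} [Fintype σ] [Field F] [Finite F]
    (P : MvPolynomial σ F) (hP : P ≠ 0) :
    Nat.card {x : σ → F // eval x P = 0} * Nat.card F ≤
      P.totalDegree * Nat.card F ^ Fintype.card σ := by
  classical
  have := Fintype.ofFinite F
  let e := Fintype.equivFin σ
  have hP' : rename e P ≠ 0 := by
    intro h
    exact hP (rename_injective e e.injective (by simpa using h))
  have hsz := schwartz_zippel_totalDegree hP' (Finset.univ : Finset F)
  have hcard : Nat.card {x : σ → F // eval x P = 0} =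
      (Finset.filter (fun f => eval f (rename e P) = 0)
        (Fintype.piFinset fun _ => (Finset.univ : Finset F))).card := by
    rw [Nat.card_eq_fintype_card, Fintype.card_subtype]
    refine Finset.card_bij' (fun x _ => x ∘ e.symm) (fun x _ => x ∘ e) ?_ ?_ ?_ ?_
    · intro x hx
      simp only [Finset.mem_filter, Finset.mem_univ, true_and] at hx
      simp [eval_rename, Function.comp_assoc, hx]
    · intro x hx
      simp only [Finset.mem_filter] at hx
      simpa [eval_rename] using hx.2
    · intro x _
      ext; simp
    · intro x _
      ext; simp
  rw [← hcard] at hsz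
  have hq : (0 : ℚ≥0) < (Fintype.card F : ℚ≥0) := by exact_mod_cast Fintype.card_pos
  rw [Finset.card_univ, div_le_div_iff₀ (pow_pos hq _) hq] at hsz
  have h2 : Nat.card {x : σ → F // eval x P = 0} * Fintype.card F ≤
      (rename e P).totalDegree * Fintype.card F ^ Fintype.card σ := by exact_mod_cast hsz
  rw [Nat.card_eq_fintype_card (α := F)]
  exact h2.trans (Nat.mul_le_mul_right _ (totalDegree_rename_le _ _))

/-- Keeping the coefficients in a fixed subfield makes nonvanishing and degree independent of the
extension `F`. -/
theorem card_aeval_zeros_mul_card_le {σ A F : Type*} [Fintype σ] [Field A] [Field F] [Algebra A F]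
    [Finite F] (P : MvPolynomial σ A) (hP : P ≠ 0) :
    Nat.card {x : σ → F // aeval x P = 0} * Nat.card F ≤
      P.totalDegree * Nat.card F ^ Fintype.card σ := by
  have h0 : map (algebraMap A F) P ≠ 0 :=
    fun h => hP (map_injective _ (algebraMap A F).injective (h.trans (map_zero _).symm))
  have h := card_zeros_mul_card_le _ h0
  have h1 (x : σ → F) : eval x (map (algebraMap A F) P) = aeval x P := by
    rw [eval_map, aeval_def]
  have h2 : (map (algebraMap A F) P).totalDegree ≤ P.totalDegree :=
    Finset.sup_mono (support_map_subset _ _)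
  simp_rw [h1] at h
  exact h.trans (Nat.mul_le_mul_right _ h2)

end MvPolynomial

/-! ### Random instances and generic events -/

namespace LCBC

open MvPolynomial

variable {F : Type} {K d : ℕ}

/-- The demand vector (`true`) or side-information vector (`false`) of a user. -/
def vec (Λ : LCBC F K d (fun _ => 1) (fun _ => 1)) (u : Fin K × Bool) : Fin d → F :=
  fun i => bif u.2 then Λ.v u.1 i 0 else Λ.v' u.1 i 0

/-- An instance as a point of affine space. -/
def coord (Λ : LCBC F K d (fun _ => 1) (fun _ => 1)) (u : (Fin K × Bool) × Fin d) : F :=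
  Λ.vec u.1 u.2

theorem coord_bijective :
    Function.Bijective (coord : LCBC F K d (fun _ => 1) (fun _ => 1) → _) := by
  constructor
  · intro Λ Λ' h
    ext k i j
    · have := congrFun h ((k, true), i)
      rw [Subsingleton.elim j 0]
      simpa [coord, vec] using this
    · have := congrFun h ((k, false), i)
      rw [Subsingleton.elim j 0]
      simpa [coord, vec] using this
  · intro c
    refine ⟨⟨fun k => Matrix.of fun i _ => c ((k, true), i),
      fun k => Matrix.of fun i _ => c ((k, false), i)⟩, ?_⟩
    ext ⟨⟨k, b⟩, i⟩
    cases b <;> simp [coord, vec]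

instance [Finite F] : Finite (LCBC F K d (fun _ => 1) (fun _ => 1)) :=
  Finite.of_injective _ coord_bijective.injective

theorem natCard_eq [Finite F] : Nat.card (LCBC F K d (fun _ => 1) (fun _ => 1)) =
    Nat.card F ^ Fintype.card ((Fin K × Bool) × Fin d) := by
  rw [Nat.card_congr (Equiv.ofBijective _ coord_bijective), Nat.card_fun,
    Nat.card_eq_fintype_card (α := _ × _)]

theorem natCard_pos [Field F] [Finite F] :
    0 < Nat.card (LCBC F K d (fun _ => 1) (fun _ => 1)) := by
  rw [natCard_eq]; exact pow_pos Nat.card_pos _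

theorem prob_le_one [Field F] [Finite F] (E : Set (LCBC F K d (fun _ => 1) (fun _ => 1))) :
    prob F K d _ _ E ≤ 1 := by
  unfold prob
  have h : (0 : ℝ) < Nat.card (LCBC F K d (fun _ => 1) (fun _ => 1)) := by
    exact_mod_cast natCard_pos
  rw [div_le_one h]
  exact_mod_cast Set.ncard_le_card _

theorem prob_mono [Finite F] {E E' : Set (LCBC F K d (fun _ => 1) (fun _ => 1))}
    (h : E ⊆ E') : prob F K d _ _ E ≤ prob F K d _ _ E' := by
  unfold prob
  gcongr
  exact Set.toFinite _

theorem prob_compl [Field F] [Finite F] (E : Set (LCBC F K d (fun _ => 1) (fun _ => 1))) :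
    prob F K d _ _ Eᶜ = 1 - prob F K d _ _ E := by
  unfold prob
  have h : (0 : ℝ) < Nat.card (LCBC F K d (fun _ => 1) (fun _ => 1)) := by
    exact_mod_cast natCard_pos
  rw [eq_sub_iff_add_eq, ← add_div, div_eq_one_iff_eq h.ne']
  exact_mod_cast (add_comm _ _).trans (Set.ncard_add_ncard_compl E)

theorem prob_inter_ge [Field F] [Finite F] (E E' : Set (LCBC F K d (fun _ => 1) (fun _ => 1))) :
    prob F K d _ _ E + prob F K d _ _ E' - 1 ≤ prob F K d _ _ (E ∩ E') := by
  have h1 : prob F K d _ _ (E ∩ E')ᶜ ≤ prob F K d _ _ Eᶜ + prob F K d _ _ E'ᶜ := by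
    unfold prob
    rw [← add_div]
    gcongr
    rw [Set.compl_inter]
    exact_mod_cast Set.ncard_union_le _ _
  simp only [prob_compl] at h1
  linarith

/-- Union bound over pairs `(Λ, r)`: a bad `Λ` contributes all its `q ^ |α|` choices of `r` to the
union of the zero sets, so the factor `q ^ |α|` cancels and `r` costs nothing. -/
theorem one_sub_le_prob_exists_aeval_ne_zero [Field F] [Finite F] {A α : Type} [Field A]
    [Algebra A F] [Fintype α]
    (S : Finset (MvPolynomial (((Fin K × Bool) × Fin d) ⊕ α) A)) (D : ℕ)
    (h0 : ∀ P ∈ S, P ≠ 0) (hD : ∀ P ∈ S, P.totalDegree ≤ D) :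
    1 - (S.card * D : ℝ) / Nat.card F ≤ prob F K d _ _
      {Λ | ∃ r : α → F, ∀ P ∈ S, aeval (Sum.elim Λ.coord r) P ≠ 0} := by
  classical
  set E : Set (LCBC F K d (fun _ => 1) (fun _ => 1)) :=
    {Λ | ∃ r : α → F, ∀ P ∈ S, aeval (Sum.elim Λ.coord r) P ≠ 0} with hE
  set q := Nat.card F with hq
  have hq0 : 0 < q := Nat.card_pos
  let σ := (((Fin K × Bool) × Fin d) ⊕ α)
  let Z : MvPolynomial σ A → Set (σ → F) := fun P => {x | aeval x P = 0}
  let φ : LCBC F K d (fun _ => 1) (fun _ => 1) × (α → F) → (σ → F) :=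
    fun y => Sum.elim y.1.coord y.2
  have hφ : Function.Injective φ := by
    rintro ⟨Λ, r⟩ ⟨Λ', r'⟩ h
    have h1 : Λ.coord = Λ'.coord := funext fun i => congrFun h (Sum.inl i)
    have h2 : r = r' := funext fun i => congrFun h (Sum.inr i)
    rw [coord_bijective.injective h1, h2]
  have hsub : φ '' (Eᶜ ×ˢ Set.univ) ⊆ ⋃ P ∈ S, Z P := by
    rintro _ ⟨⟨Λ, r⟩, ⟨hΛ, -⟩, rfl⟩
    simp only [hE, Set.mem_compl_iff, Set.mem_ofPred_eq, not_exists, not_forall, not_not] at hΛ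
    obtain ⟨P, hP, h⟩ := hΛ r
    simp only [Set.mem_iUnion]
    exact ⟨P, hP, h⟩
  have hcard1 : Eᶜ.ncard * q ^ Fintype.card α ≤ ∑ P ∈ S, (Z P).ncard := by
    calc Eᶜ.ncard * q ^ Fintype.card α = (φ '' (Eᶜ ×ˢ Set.univ)).ncard := by
          rw [Set.ncard_image_of_injective _ hφ, Set.ncard_prod, Set.ncard_univ, Nat.card_fun,
            Nat.card_eq_fintype_card (α := α)]
      _ ≤ (⋃ P ∈ S, Z P).ncard := Set.ncard_le_ncard hsub (Set.toFinite _)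
      _ ≤ ∑ P ∈ S, (Z P).ncard := Finset.set_ncard_biUnion_le _ _
  have hcard2 : (∑ P ∈ S, (Z P).ncard) * q ≤ S.card * D * q ^ Fintype.card σ := by
    rw [Finset.sum_mul, mul_assoc, ← smul_eq_mul, ← Finset.sum_const]
    refine Finset.sum_le_sum fun P hP => ?_
    refine (card_aeval_zeros_mul_card_le (F := F) P (h0 P hP)).trans ?_
    exact Nat.mul_le_mul_right _ (hD P hP)
  have hσ : Fintype.card σ = Fintype.card ((Fin K × Bool) × Fin d) + Fintype.card α :=
    Fintype.card_sum
  have hcard3 : Eᶜ.ncard * q ≤ S.card * D * q ^ Fintype.card ((Fin K × Bool) × Fin d) := by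
    have h3 : (Eᶜ.ncard * q) * q ^ Fintype.card α ≤
        (S.card * D * q ^ Fintype.card ((Fin K × Bool) × Fin d)) * q ^ Fintype.card α := by
      calc (Eᶜ.ncard * q) * q ^ Fintype.card α = (Eᶜ.ncard * q ^ Fintype.card α) * q := by ring
        _ ≤ (∑ P ∈ S, (Z P).ncard) * q := Nat.mul_le_mul_right _ hcard1
        _ ≤ _ := hcard2
        _ = _ := by rw [hσ, pow_add]; ring
    exact Nat.le_of_mul_le_mul_right h3 (pow_pos hq0 _)
  have hfin : prob F K d _ _ Eᶜ ≤ (S.card * D : ℝ) / q := by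
    unfold prob
    rw [natCard_eq, div_le_div_iff₀ (by exact_mod_cast pow_pos hq0 _) (by exact_mod_cast hq0)]
    exact_mod_cast hcard3
  rw [prob_compl] at hfin
  linarith

section Generic

variable {p : ℕ} [Fact p.Prime]

/-- A family of events has probability tending to one as the field grows. -/
def Generically (E : ∀ n, Set (LCBC (GaloisField p n) K d (fun _ => 1) (fun _ => 1))) : Prop :=
  Tendsto (fun n => prob (GaloisField p n) K d _ _ (E n)) atTop (𝓝 1)

theorem Generically.mono {E E' : ∀ n, Set (LCBC (GaloisField p n) K d (fun _ => 1) (fun _ => 1))}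
    (h : Generically E) (hE : ∀ᶠ n in atTop, E n ⊆ E' n) : Generically E' :=
  tendsto_of_tendsto_of_tendsto_of_le_of_le' h tendsto_const_nhds
    (hE.mono fun _ h => prob_mono h) (Eventually.of_forall fun _ => prob_le_one _)

theorem Generically.inter
    {E E' : ∀ n, Set (LCBC (GaloisField p n) K d (fun _ => 1) (fun _ => 1))}
    (h : Generically E) (h' : Generically E') : Generically fun n => E n ∩ E' n := by
  have h1 := (h.add h').sub_const 1
  norm_num at h1
  exact tendsto_of_tendsto_of_tendsto_of_le_of_le h1 tendsto_const_nhds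
    (fun _ => prob_inter_ge _ _) fun _ => prob_le_one _

theorem Generically.iInter {ι : Type*} [Finite ι]
    {E : ι → ∀ n, Set (LCBC (GaloisField p n) K d (fun _ => 1) (fun _ => 1))}
    (h : ∀ i, Generically (E i)) : Generically fun n => ⋂ i, E i n := by
  classical
  have := Fintype.ofFinite ι
  suffices H : ∀ s : Finset ι, Generically fun n => ⋂ i ∈ s, E i n by
    simpa using H Finset.univ
  intro s
  induction s using Finset.induction_on with
  | empty =>
    have : ∀ n, prob (GaloisField p n) K d (fun _ => 1) (fun _ => 1) Set.univ = 1 := fun _ => by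
      unfold prob
      rw [Set.ncard_univ, div_self]
      exact_mod_cast natCard_pos.ne'
    simp [Generically, this]
  | insert i s _ ih =>
    simp only [Finset.set_biInter_insert]
    exact (h i).inter ih

theorem generically_aeval_coord_ne_zero
    (P : MvPolynomial ((Fin K × Bool) × Fin d) (ZMod p)) (hP : P ≠ 0) :
    Generically (p := p) fun _ => {Λ | aeval Λ.coord P ≠ 0} := by
  have hp := (Fact.out : p.Prime)
  have hlim : Tendsto (fun n : ℕ => 1 - (P.totalDegree : ℝ) / (p : ℝ) ^ n) atTop (𝓝 1) := by
    have h1 : Tendsto (fun n : ℕ => (p : ℝ) ^ n) atTop atTop :=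
      tendsto_pow_atTop_atTop_of_one_lt (by exact_mod_cast hp.one_lt)
    simpa using (tendsto_const_nhds (x := (1 : ℝ))).sub
      (tendsto_const_nhds (x := (P.totalDegree : ℝ)).div_atTop h1)
  refine tendsto_of_tendsto_of_tendsto_of_le_of_le' hlim tendsto_const_nhds ?_
    (Eventually.of_forall fun _ => prob_le_one _)
  filter_upwards [eventually_ne_atTop 0] with n hn
  have h := one_sub_le_prob_exists_aeval_ne_zero (F := GaloisField p n) (K := K) (d := d)
    (A := ZMod p) (α := Empty) {rename Sum.inl P} P.totalDegree
    (by
      simp only [Finset.mem_singleton, forall_eq]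
      intro h
      exact hP (rename_injective _ Sum.inl_injective (by simpa using h)))
    (by
      simp only [Finset.mem_singleton, forall_eq]
      exact totalDegree_rename_le _ _)
  rw [GaloisField.card p n hn] at h
  simp only [Finset.card_singleton, Nat.cast_one, one_mul, Nat.cast_pow] at h
  refine h.trans (prob_mono ?_)
  rintro Λ ⟨r, hr⟩
  have := hr _ (Finset.mem_singleton_self _)
  rwa [aeval_rename, Sum.elim_comp_inl] at this

end Generic

end LCBC

/-! ### A counting form of submodularity, and dual families -/

/-- Since `C` factors through `D`, distinct fibres of `C` have disjoint images under `D`. -/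
theorem sum_card_image_fiber_le {X γ δ : Type*} [Fintype X] [Fintype δ] [DecidableEq γ]
    [DecidableEq δ] (C : X → γ) (D : X → δ) (hD : ∀ x y, D x = D y → C x = C y) :
    ∑ c ∈ Finset.univ.image C, ((Finset.univ.filter fun x => C x = c).image D).card ≤
      Fintype.card δ := by
  rw [← Finset.card_biUnion]
  · exact Finset.card_le_univ _
  · intro c _ c' _ hne
    rw [Function.onFun, Finset.disjoint_left]
    intro a ha ha'
    obtain ⟨x, hx, rfl⟩ := Finset.mem_image.1 ha
    obtain ⟨y, hy, hxy⟩ := Finset.mem_image.1 ha'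
    exact hne ((Finset.mem_filter.1 hx).2.symm.trans
      ((hD _ _ hxy.symm).trans (Finset.mem_filter.1 hy).2))

/-- If `C` is a function of `A` and a function of `B`, and both `(A, B)` and `(C, Z)` are injective,
then `|X|² ≤ |α| |β| |ζ|`. -/
theorem card_sq_le_of_common_function {X α β γ ζ : Type*} [Finite X] [Finite α] [Finite β]
    [Finite ζ] (A : X → α) (B : X → β) (C : X → γ) (Z : X → ζ)
    (hA : ∀ x y, A x = A y → C x = C y) (hB : ∀ x y, B x = B y → C x = C y)
    (hAB : ∀ x y, A x = A y → B x = B y → x = y) (hCZ : ∀ x y, C x = C y → Z x = Z y → x = y) :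
    Nat.card X ^ 2 ≤ Nat.card α * Nat.card β * Nat.card ζ := by
  classical
  have := Fintype.ofFinite X
  have := Fintype.ofFinite α
  have := Fintype.ofFinite β
  have := Fintype.ofFinite ζ
  simp only [Nat.card_eq_fintype_card]
  let T : Finset γ := Finset.univ.image C
  let fib : γ → Finset X := fun c => Finset.univ.filter fun x => C x = c
  have hmem : ∀ {x c}, x ∈ fib c ↔ C x = c := by simp [fib]
  have hX : Fintype.card X = ∑ c ∈ T, (fib c).card :=
    Finset.card_eq_sum_card_image C Finset.univ
  have hsq : ∀ c ∈ T, (fib c).card ^ 2 ≤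
      (((fib c).image A).card * Fintype.card ζ) * ((fib c).image B).card := by
    intro c _
    have h1 : (fib c).card ≤ ((fib c).image A).card * ((fib c).image B).card := by
      rw [← Finset.card_product]
      refine Finset.card_le_card_of_injOn (fun x => (A x, B x)) ?_ ?_
      · intro x hx
        exact Finset.mem_product.2 ⟨Finset.mem_image_of_mem _ hx, Finset.mem_image_of_mem _ hx⟩
      · intro x _ y _ h
        exact hAB _ _ (congrArg Prod.fst h) (congrArg Prod.snd h)
    have h2 : (fib c).card ≤ Fintype.card ζ := by
      refine Finset.card_le_card_of_injOn Z (fun _ _ => Finset.mem_univ _) ?_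
      intro x hx y hy h
      exact hCZ _ _ ((hmem.1 hx).trans (hmem.1 hy).symm) h
    calc (fib c).card ^ 2 = (fib c).card * (fib c).card := sq _
      _ ≤ (((fib c).image A).card * ((fib c).image B).card) * Fintype.card ζ :=
        Nat.mul_le_mul h1 h2
      _ = _ := by ring
  rw [hX]
  -- Cauchy–Schwarz over the fibres of `C` plays the role of the entropy inequalities `H(A) + H(B) ≥
  -- H(A, B) + H(C)` and `H(C) + H(Z) ≥ H(X)`.
  refine (Finset.sum_sq_le_sum_mul_sum_of_sq_le_mul T (fun _ _ => Nat.zero_le _)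
    (fun _ _ => Nat.zero_le _) hsq).trans ?_
  rw [← Finset.sum_mul, mul_right_comm]
  exact Nat.mul_le_mul_right _ (Nat.mul_le_mul
    (sum_card_image_fiber_le C A hA) (sum_card_image_fiber_le C B hB))

theorem LinearIndependent.exists_dual_dotProduct {F ι : Type*} [Field F] [Fintype ι]
    [DecidableEq ι] {d : ℕ} {u : ι → Fin d → F} (hu : LinearIndependent F u) :
    ∃ y : ι → Fin d → F, ∀ i k, y i ⬝ᵥ u k = if i = k then 1 else 0 := by
  have hker : (Fintype.linearCombination F u).ker = ⊥ :=
    LinearMap.ker_eq_bot.2 (hu.fintypeLinearCombination_injective)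
  obtain ⟨g, hg⟩ := LinearMap.exists_leftInverse_of_injective _ hker
  refine ⟨fun i j => g (Pi.single j 1) i, fun i k => ?_⟩
  have h1 : g (u k) = Pi.single k 1 := by
    have := LinearMap.congr_fun hg (Pi.single k 1)
    simpa [Fintype.linearCombination_apply_single] using this
  have h2 : u k = ∑ j, u k j • (Pi.single j 1 : Fin d → F) := pi_eq_sum_univ' (u k)
  have h3 : g (u k) i = (fun j => g (Pi.single j 1) i) ⬝ᵥ u k := by
    conv_lhs => rw [h2]
    simp [dotProduct, mul_comm]
  rw [← h3, h1, Pi.single_apply]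

/-! ### Coding schemes and elementary cost bounds -/

namespace LCBC

variable {F : Type} [Field F] {K d : ℕ}

theorem transpose_mul_v (Λ : LCBC F K d (fun _ => 1) (fun _ => 1)) {L : ℕ}
    (x : Matrix (Fin d) (Fin L) F) (k : Fin K) (l : Fin L) (j : Fin 1) :
    (x.transpose * Λ.v k) l j = x.transpose.mulVec (Λ.vec (k, true)) l := by
  rw [Subsingleton.elim j 0]; rfl

theorem transpose_mul_v' (Λ : LCBC F K d (fun _ => 1) (fun _ => 1)) {L : ℕ}
    (x : Matrix (Fin d) (Fin L) F) (k : Fin K) (l : Fin L) (j : Fin 1) :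
    (x.transpose * Λ.v' k) l j = x.transpose.mulVec (Λ.vec (k, false)) l := by
  rw [Subsingleton.elim j 0]; rfl

/-- The vectors along which two data matrices have the same projection. -/
def agreement {L : ℕ} (x y : Matrix (Fin d) (Fin L) F) : Submodule F (Fin d → F) :=
  LinearMap.eqLocus x.transpose.mulVecLin y.transpose.mulVecLin

theorem mem_agreement {L : ℕ} {x y : Matrix (Fin d) (Fin L) F} {w : Fin d → F} :
    w ∈ agreement x y ↔ x.transpose.mulVec w = y.transpose.mulVec w := Iff.rfl

theorem eq_of_agreement_eq_top {L : ℕ} {x y : Matrix (Fin d) (Fin L) F}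
    (h : agreement x y = ⊤) : x = y := by
  have : x.transpose.mulVecLin = y.transpose.mulVecLin := LinearMap.eqLocus_eq_top.1 h
  exact Matrix.transpose_injective (Matrix.toLin'.injective this)

theorem AchievableScheme.demand_mem_agreement {Λ : LCBC F K d (fun _ => 1) (fun _ => 1)}
    (σ : Λ.AchievableScheme) {x y : Matrix (Fin d) (Fin σ.L) F} (hxy : σ.enc x = σ.enc y)
    {k : Fin K} (h : Λ.vec (k, false) ∈ agreement x y) : Λ.vec (k, true) ∈ agreement x y := by
  rw [mem_agreement] at h ⊢
  have h1 : x.transpose * Λ.v' k = y.transpose * Λ.v' k := by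
    ext l j
    rw [transpose_mul_v', transpose_mul_v', h]
  have h2 : x.transpose * Λ.v k = y.transpose * Λ.v k := by
    rw [← σ.decodes, ← σ.decodes, hxy, h1]
  ext l
  rw [← transpose_mul_v _ _ _ _ 0, ← transpose_mul_v _ _ _ _ 0, h2]

/-- A scheme of batch size one from an additive encoder. -/
theorem exists_scheme_of_addMonoidHom (Λ : LCBC F K d (fun _ => 1) (fun _ => 1)) {S : Type}
    [AddCommGroup S] [Finite S] (enc : (Fin d → F) →+ S)
    (h : ∀ k z, enc z = 0 → z ⬝ᵥ Λ.vec (k, false) = 0 → z ⬝ᵥ Λ.vec (k, true) = 0) :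
    ∃ σ : Λ.AchievableScheme, σ.cost = Real.logb (Nat.card F) (Nat.card S) := by
  classical
  refine ⟨{ L := 1, one_le_L := le_rfl, Alphabet := S, finite_alphabet := inferInstance,
            enc := fun x => enc fun i => x i 0
            -- The decoder picks any data consistent with what it sees; by additivity two candidates
            -- differ by an element to which `h` applies. The default `0` is never reached on a
            -- genuine broadcast.
            dec := fun k s y =>
              if hx : ∃ x : Matrix (Fin d) (Fin 1) F,
                (enc fun i => x i 0) = s ∧ x.transpose * Λ.v' k = y
              then hx.choose.transpose * Λ.v k else 0
            decodes := ?_ }, by simp [AchievableScheme.cost]⟩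
  intro x k
  have hx : ∃ y : Matrix (Fin d) (Fin 1) F,
      (enc fun i => y i 0) = (enc fun i => x i 0) ∧
        y.transpose * Λ.v' k = x.transpose * Λ.v' k := ⟨x, rfl, rfl⟩
  rw [dif_pos hx]
  obtain ⟨h1, h2⟩ := hx.choose_spec
  set y := hx.choose
  have h3 := h k ((fun i => y i 0) - fun i => x i 0) (by rw [map_sub, h1, sub_self]) (by
    rw [sub_dotProduct, sub_eq_zero]
    exact congrFun (congrFun h2 0) 0)
  rw [sub_dotProduct, sub_eq_zero] at h3
  ext l j
  rw [Subsingleton.elim j 0, Subsingleton.elim l 0]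
  exact h3

variable [Finite F]

theorem AchievableScheme.cost_nonneg {Λ : LCBC F K d (fun _ => 1) (fun _ => 1)}
    (σ : Λ.AchievableScheme) : 0 ≤ σ.cost := by
  have := σ.finite_alphabet
  have : Nonempty σ.Alphabet := ⟨σ.enc 0⟩
  refine div_nonneg (Real.logb_nonneg ?_ ?_) (Nat.cast_nonneg _)
  · exact_mod_cast Finite.one_lt_card
  · exact_mod_cast Nat.card_pos

theorem optimalCost_le_cost {Λ : LCBC F K d (fun _ => 1) (fun _ => 1)}
    (σ : Λ.AchievableScheme) : Λ.optimalCost ≤ σ.cost :=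
  csInf_le ⟨0, by rintro _ ⟨τ, rfl⟩; exact τ.cost_nonneg⟩ ⟨σ, rfl⟩

/-- Only additivity is required, not `F`-linearity, so `S` may be a space over the prime field and
fractional costs occur already at batch size one. -/
theorem optimalCost_le_logb (Λ : LCBC F K d (fun _ => 1) (fun _ => 1)) {S : Type}
    [AddCommGroup S] [Finite S] (enc : (Fin d → F) →+ S)
    (h : ∀ k z, enc z = 0 → z ⬝ᵥ Λ.vec (k, false) = 0 → z ⬝ᵥ Λ.vec (k, true) = 0) :
    Λ.optimalCost ≤ Real.logb (Nat.card F) (Nat.card S) := by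
  obtain ⟨σ, hσ⟩ := Λ.exists_scheme_of_addMonoidHom enc h
  exact hσ ▸ optimalCost_le_cost σ

theorem le_optimalCost {Λ : LCBC F K d (fun _ => 1) (fun _ => 1)} {c : ℝ}
    (h : ∀ σ : Λ.AchievableScheme, c ≤ σ.cost) : c ≤ Λ.optimalCost := by
  refine le_csInf ?_ ?_
  · obtain ⟨σ, -⟩ := Λ.exists_scheme_of_addMonoidHom (AddMonoidHom.id (Fin d → F)) (by
      rintro k z rfl -
      exact zero_dotProduct _)
    exact ⟨_, σ, rfl⟩
  · rintro _ ⟨σ, rfl⟩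
    exact h σ

theorem optimalCost_nonneg (Λ : LCBC F K d (fun _ => 1) (fun _ => 1)) : 0 ≤ Λ.optimalCost :=
  le_optimalCost fun σ => σ.cost_nonneg

theorem AchievableScheme.div_le_cost {Λ : LCBC F K d (fun _ => 1) (fun _ => 1)}
    (σ : Λ.AchievableScheme) {a b : ℕ} (hb : 0 < b)
    (h : Nat.card F ^ (a * σ.L) ≤ Nat.card σ.Alphabet ^ b) : (a / b : ℝ) ≤ σ.cost := by
  have hq : 1 < (Nat.card F : ℝ) := by exact_mod_cast Finite.one_lt_card
  have hL : (0 : ℝ) < σ.L := by exact_mod_cast σ.one_le_L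
  have hb' : (0 : ℝ) < b := by exact_mod_cast hb
  have h1 : (Nat.card F : ℝ) ^ (a * σ.L) ≤ (Nat.card σ.Alphabet : ℝ) ^ b := by exact_mod_cast h
  have h2 := Real.logb_le_logb_of_le hq (by positivity) h1
  rw [Real.logb_pow, Real.logb_pow, Real.logb_self_eq_one hq, mul_one, Nat.cast_mul] at h2
  unfold AchievableScheme.cost
  rw [div_le_div_iff₀ hb' hL]
  linarith

/-- Data supported on the duals of the demand vectors have zero side information for the chosen
users, so the encoder must separate all `q ^ (t L)` demand values. -/
theorem natCast_le_optimalCost (Λ : LCBC F K d (fun _ => 1) (fun _ => 1)) {t : ℕ}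
    (e : Fin t → Fin K)
    (h : LinearIndependent F fun u : Fin t × Bool => Λ.vec (e u.1, u.2)) :
    (t : ℝ) ≤ Λ.optimalCost := by
  refine le_optimalCost fun σ => ?_
  have := σ.finite_alphabet
  obtain ⟨y, hy⟩ := h.exists_dual_dotProduct
  let X : (Fin t → Fin σ.L → F) → Matrix (Fin d) (Fin σ.L) F :=
    fun a => Matrix.of fun i l => ∑ k, a k l * y (k, true) i
  have hX : ∀ a k b, (X a).transpose.mulVec (Λ.vec (e k, b)) = if b then a k else 0 := by
    intro a k b
    ext l
    have h1 : ∀ k', y (k', true) ⬝ᵥ Λ.vec (e k, b) = if (k', true) = (k, b) then 1 else 0 :=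
      fun k' => hy (k', true) (k, b)
    have : (X a).transpose.mulVec (Λ.vec (e k, b)) l =
        ∑ k', a k' l * (y (k', true) ⬝ᵥ Λ.vec (e k, b)) := by
      simp only [X, Matrix.mulVec, dotProduct, Matrix.transpose_apply, Matrix.of_apply,
        Finset.sum_mul, Finset.mul_sum]
      rw [Finset.sum_comm]
      simp only [mul_assoc]
    rw [this]
    cases b <;> simp [h1]
  have hinj : Function.Injective fun a => σ.enc (X a) := by
    intro a a' haa
    ext k l
    have h1 : Λ.vec (e k, false) ∈ agreement (X a) (X a') := by
      rw [mem_agreement, hX, hX]; simp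
    have h2 := mem_agreement.1 (σ.demand_mem_agreement haa h1)
    rw [hX, hX] at h2
    exact congrFun (by simpa using h2) l
  have hcard := Nat.card_le_card_of_injective _ hinj
  rw [Nat.card_fun, Nat.card_fun, Nat.card_eq_fintype_card (α := Fin t),
    Nat.card_eq_fintype_card (α := Fin _), Fintype.card_fin, Fintype.card_fin, ← pow_mul] at hcard
  have h1 := σ.div_le_cost (a := t) (b := 1) one_pos (by rwa [pow_one, mul_comm])
  simpa using h1

end LCBC

/-! ### Hyperplanes cut out by a determinant in its last row -/

section LastRow

variable {R F ι : Type*} [CommRing R] [Field F] [Fintype ι] [DecidableEq ι] {d : ℕ}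

/-- The determinant of the square matrix with rows `u i` and last row `w`. -/
def lastRowDet (ρ : Option ι ≃ Fin d) (u : ι → Fin d → R) (w : Fin d → R) : R :=
  Matrix.det (Matrix.of fun o j => (o.elim w u : Fin d → R) (ρ j))

theorem map_lastRowDet {R' : Type*} [CommRing R'] (φ : R →+* R') (ρ : Option ι ≃ Fin d)
    (u : ι → Fin d → R) (w : Fin d → R) :
    φ (lastRowDet ρ u w) = lastRowDet ρ (fun i j => φ (u i j)) (fun j => φ (w j)) := by
  unfold lastRowDet
  rw [RingHom.map_det]
  congr 1
  ext o j
  cases o <;> rfl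

theorem exists_linearMap_lastRowDet (ρ : Option ι ≃ Fin d) (u : ι → Fin d → R) :
    ∃ f : (Fin d → R) →ₗ[R] R, ∀ w, f w = lastRowDet ρ u w := by
  refine ⟨((Matrix.detRowAlternating (n := Option ι) (R := R)).toMultilinearMap.toLinearMap
    (fun o j => (o.elim 0 u : Fin d → R) (ρ j)) none) ∘ₗ LinearMap.funLeft R R ρ, fun w => ?_⟩
  simp only [LinearMap.comp_apply, MultilinearMap.toLinearMap_apply, lastRowDet]
  change Matrix.det _ = _
  congr 1
  ext o j
  cases o <;> simp [LinearMap.funLeft_apply]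

theorem lastRowDet_apply_self (ρ : Option ι ≃ Fin d) (u : ι → Fin d → R) (i : ι) :
    lastRowDet ρ u (u i) = 0 :=
  Matrix.det_zero_of_row_eq (i := none) (j := some i) (by simp) rfl

theorem eq_top_of_lastRowDet_ne_zero {ρ : Option ι ≃ Fin d} {u : ι → Fin d → F}
    {w : Fin d → F} (h : lastRowDet ρ u w ≠ 0) {E : Submodule F (Fin d → F)}
    (hu : ∀ i, u i ∈ E) (hw : w ∈ E) : E = ⊤ := by
  have h1 : LinearIndependent F fun o : Option ι => (o.elim w u : Fin d → F) :=
    LinearIndependent.of_comp (LinearMap.funLeft F F ρ)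
      (Matrix.linearIndependent_rows_of_det_ne_zero h)
  have h2 := h1.span_eq_top_of_card_eq_finrank (by rw [Fintype.card_congr ρ]; simp)
  rw [eq_top_iff, ← h2, Submodule.span_le]
  rintro _ ⟨o, rfl⟩
  cases o with
  | none => exact hw
  | some i => exact hu i

/-- The determinant functional kills the span of `u`, and `w₀`, where it is nonzero, supplements
that span; hence its kernel is no larger. -/
theorem mem_span_of_lastRowDet_eq_zero {ρ : Option ι ≃ Fin d} {u : ι → Fin d → F}
    {w₀ w : Fin d → F} (h₀ : lastRowDet ρ u w₀ ≠ 0) (h : lastRowDet ρ u w = 0) :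
    w ∈ Submodule.span F (Set.range u) := by
  obtain ⟨f, hf⟩ := exists_linearMap_lastRowDet ρ u
  have htop : Submodule.span F (Set.range u) ⊔ Submodule.span F {w₀} = ⊤ :=
    eq_top_of_lastRowDet_ne_zero h₀
      (fun i => Submodule.mem_sup_left (Submodule.subset_span ⟨i, rfl⟩))
      (Submodule.mem_sup_right (Submodule.mem_span_singleton_self _))
  have hw : w ∈ Submodule.span F (Set.range u) ⊔ Submodule.span F {w₀} := htop ▸ trivial
  obtain ⟨y, hy, z, hz, rfl⟩ := Submodule.mem_sup.1 hw
  obtain ⟨c, rfl⟩ := Submodule.mem_span_singleton.1 hz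
  have hfy : f y = 0 := by
    have hle : Submodule.span F (Set.range u) ≤ f.ker := by
      rw [Submodule.span_le]
      rintro _ ⟨i, rfl⟩
      exact (hf _).trans (lastRowDet_apply_self ρ u i)
    exact hle hy
  rw [← hf, map_add, hfy, zero_add, map_smul, hf, smul_eq_mul] at h
  rw [(mul_eq_zero.1 h).resolve_right h₀, zero_smul, add_zero]
  exact hy

theorem lastRowDet_single_perm (ρ : Option ι ≃ Fin d) (u : ι → Fin d → R) (w : Fin d → R)
    (π : Equiv.Perm (Option ι)) (hw : w = Pi.single (ρ (π none)) 1)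
    (hu : ∀ i, u i = Pi.single (ρ (π (some i))) 1) :
    lastRowDet ρ u w = ((Equiv.Perm.sign π : ℤ) : R) := by
  have : (Matrix.of fun o j => (o.elim w u : Fin d → R) (ρ j)) =
      (1 : Matrix (Option ι) (Option ι) R).submatrix π id := by
    ext o j
    cases o <;> simp [hw, hu, Matrix.one_apply, Pi.single_apply, eq_comm]
  rw [lastRowDet, this, Matrix.det_permute, Matrix.det_one, mul_one]

end LastRow

/-! ### The lower bound `d / 2` for odd `d` -/

namespace LCBC

open MvPolynomial

variable {F : Type} [Field F] {K d : ℕ}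

/-- If the planes of users `B` and `C` are separated by the plane of user `A` modulo the planes of
the users `e i`, the broadcast cost is at least `d / 2`. -/
theorem half_le_optimalCost [Finite F] (Λ : LCBC F K d (fun _ => 1) (fun _ => 1)) {s : ℕ}
    (hd : d = 2 * s + 3) (e : Fin s → Fin K) (A B C : Fin K)
    (ρ : Option (Option (Fin s) × Bool) ≃ Fin d)
    (h : lastRowDet ρ (fun i => Λ.vec (i.1.elim B e, i.2)) (Λ.vec (A, false)) *
        lastRowDet ρ (fun i => Λ.vec (i.1.elim C e, i.2)) (Λ.vec (A, true)) -
      lastRowDet ρ (fun i => Λ.vec (i.1.elim B e, i.2)) (Λ.vec (A, true)) *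
        lastRowDet ρ (fun i => Λ.vec (i.1.elim C e, i.2)) (Λ.vec (A, false)) ≠ 0) :
    (d / 2 : ℝ) ≤ Λ.optimalCost := by
  refine le_optimalCost fun σ => ?_
  have := σ.finite_alphabet
  set uB : Option (Fin s) × Bool → Fin d → F := fun i => Λ.vec (i.1.elim B e, i.2) with huB
  set uC : Option (Fin s) × Bool → Fin d → F := fun i => Λ.vec (i.1.elim C e, i.2) with huC
  obtain ⟨f, hf⟩ := exists_linearMap_lastRowDet ρ uB
  obtain ⟨g, hg⟩ := exists_linearMap_lastRowDet ρ uC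
  set a := Λ.vec (A, true)
  set a' := Λ.vec (A, false)
  rw [← hf, ← hf, ← hg, ← hg] at h
  -- The combination of A's vectors killed by `f`, hence lying in the span of `uB`; the hypothesis
  -- `h` says exactly that `g ell ≠ 0`.
  set ell : Fin d → F := f a' • a - f a • a' with hell
  have hfell : f ell = 0 := by simp [hell, mul_comm]
  have hgell : lastRowDet ρ uC ell ≠ 0 := by rw [← hg]; simpa [hell] using h
  obtain ⟨b, hb⟩ : ∃ b, lastRowDet ρ uB (Λ.vec (A, b)) ≠ 0 := by
    by_contra! hcon
    exact h (by rw [hf, hf, hcon true, hcon false]; ring)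
  have hellB : ell ∈ Submodule.span F (Set.range uB) :=
    mem_span_of_lastRowDet_eq_zero hb ((hf ell).symm.trans hfell)
  let X := Matrix (Fin d) (Fin σ.L) F
  let side : Fin K → X → Fin σ.L → F := fun k x => x.transpose.mulVec (Λ.vec (k, false))
  let fA : X → σ.Alphabet × (Fin s → Fin σ.L → F) × (Fin σ.L → F) :=
    fun x => (σ.enc x, fun i => side (e i) x, side A x)
  let fB : X → σ.Alphabet × (Fin s → Fin σ.L → F) × (Fin σ.L → F) :=
    fun x => (σ.enc x, fun i => side (e i) x, side B x)
  let fC : X → σ.Alphabet × (Fin s × Bool → Fin σ.L → F) × (Fin σ.L → F) :=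
    fun x => (σ.enc x, fun i => x.transpose.mulVec (Λ.vec (e i.1, i.2)), x.transpose.mulVec ell)
  have key : ∀ {x y : X} {k}, σ.enc x = σ.enc y → side k x = side k y →
      ∀ b, Λ.vec (k, b) ∈ agreement x y := by
    intro x y k hxy hk b
    cases b
    · exact hk
    · exact σ.demand_mem_agreement hxy hk
  have hkeyB : ∀ x y, fB x = fB y → ∀ i, uB i ∈ agreement x y := by
    intro x y hxy
    simp only [fB, Prod.mk.injEq] at hxy
    rintro ⟨_ | i, b⟩
    · exact key hxy.1 hxy.2.2 b
    · exact key hxy.1 (congrFun hxy.2.1 i) b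
  have hcard := card_sq_le_of_common_function fA fB fC (side C) ?_ ?_ ?_ ?_
  · have hX : Nat.card X = Nat.card (Fin d → Fin σ.L → F) := rfl
    rw [hX, Nat.card_prod, Nat.card_prod] at hcard
    simp only [Nat.card_fun, Nat.card_eq_fintype_card (α := Fin _), Fintype.card_fin] at hcard
    set q := Nat.card F with hq
    have hq0 : 0 < q := Nat.card_pos
    -- `fA` and `fB` each carry `s + 1` side informations and `side C` one more, `2 * s + 3 = d` in
    -- total, which cancels half of `|X| ^ 2`.
    have h1 : q ^ (d * σ.L) * q ^ ((2 * s + 3) * σ.L) ≤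
        Nat.card σ.Alphabet ^ 2 * q ^ ((2 * s + 3) * σ.L) := by
      calc q ^ (d * σ.L) * q ^ ((2 * s + 3) * σ.L) = ((q ^ σ.L) ^ d) ^ 2 := by
            rw [← hd]; ring
        _ ≤ _ := hcard
        _ = _ := by ring
    exact_mod_cast σ.div_le_cost (a := d) (b := 2) two_pos
      (Nat.le_of_mul_le_mul_right h1 (pow_pos hq0 _))
  · intro x y hxy
    simp only [fA, Prod.mk.injEq] at hxy
    refine Prod.ext hxy.1 (Prod.ext (funext fun i => ?_) ?_)
    · exact key hxy.1 (congrFun hxy.2.1 i.1) i.2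
    · exact (agreement x y).sub_mem ((agreement x y).smul_mem _ (key hxy.1 hxy.2.2 true))
        ((agreement x y).smul_mem _ (key hxy.1 hxy.2.2 false))
  · intro x y hxy
    have hB := hkeyB x y hxy
    refine Prod.ext (congrArg Prod.fst hxy :) (Prod.ext (funext fun i => ?_) ?_)
    · exact hB (some i.1, i.2)
    · have hle : Submodule.span F (Set.range uB) ≤ agreement x y := by
        rw [Submodule.span_le]
        rintro _ ⟨i, rfl⟩
        exact hB i
      exact hle hellB
  · intro x y hA hB
    simp only [fA, Prod.mk.injEq] at hA
    exact eq_of_agreement_eq_top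
      (eq_top_of_lastRowDet_ne_zero hb (hkeyB x y hB) (key hA.1 hA.2.2 b))
  · intro x y hC hZ
    simp only [fC, Prod.mk.injEq] at hC
    refine eq_of_agreement_eq_top (eq_top_of_lastRowDet_ne_zero hgell ?_ hC.2.2)
    rintro ⟨_ | i, b⟩
    · exact key hC.1 hZ b
    · exact congrFun hC.2.1 (i, b)

variable {p : ℕ} [Fact p.Prime]

theorem generically_linearIndependent {ι : Type} [Fintype ι] (e : ι → Fin K × Bool)
    (he : Function.Injective e) (hcard : Fintype.card ι ≤ d) :
    Generically (p := p) fun n => {Λ : LCBC (GaloisField p n) K d _ _ |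
      LinearIndependent (GaloisField p n) fun i => Λ.vec (e i)} := by
  classical
  obtain ⟨g⟩ : Nonempty (ι ↪ Fin d) := Function.Embedding.nonempty_of_card_le (by simpa)
  let P : MvPolynomial ((Fin K × Bool) × Fin d) (ZMod p) :=
    Matrix.det (Matrix.of fun i j => X (e i, g j))
  have hP : P ≠ 0 := by
    intro h
    -- At this 0-1 point the chosen minor is the identity matrix.
    have h1 : aeval (fun x : (Fin K × Bool) × Fin d =>
        if ∃ i, e i = x.1 ∧ g i = x.2 then (1 : ZMod p) else 0) P = 1 := by
      rw [AlgHom.map_det]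
      convert Matrix.det_one (n := ι) (R := ZMod p)
      ext i j
      simp only [AlgHom.mapMatrix_apply, Matrix.map_apply, Matrix.of_apply, aeval_X,
        Matrix.one_apply]
      congr 1
      refine propext ⟨?_, ?_⟩
      · rintro ⟨k, h1, h2⟩
        rw [← he h1, ← g.injective h2]
      · rintro rfl
        exact ⟨i, rfl, rfl⟩
    rw [h, map_zero] at h1
    exact zero_ne_one h1
  refine (generically_aeval_coord_ne_zero P hP).mono (Eventually.of_forall fun n Λ hΛ => ?_)
  have h1 : (Matrix.of fun i j => Λ.vec (e i) (g j)).det ≠ 0 := by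
    have h2 : aeval Λ.coord P ≠ 0 := hΛ
    rw [AlgHom.map_det] at h2
    convert h2
    ext i j
    simp [coord]
  exact LinearIndependent.of_comp (LinearMap.funLeft _ _ g)
    (Matrix.linearIndependent_rows_of_det_ne_zero h1)

theorem generically_half_le_optimalCost {s : ℕ} (hd : d = 2 * s + 3) (hK : s + 3 ≤ K) :
    Generically (p := p) fun n => {Λ : LCBC (GaloisField p n) K d _ _ |
      (d / 2 : ℝ) ≤ Λ.optimalCost} := by
  have ρ : Option (Option (Fin s) × Bool) ≃ Fin d :=
    Fintype.equivOfCardEq (by simp [hd]; ring)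
  let e : Fin s → Fin K := Fin.castLE (by omega)
  let A : Fin K := ⟨s, by omega⟩
  let B : Fin K := ⟨s + 1, by omega⟩
  let C : Fin K := ⟨s + 2, by omega⟩
  let x : Fin K × Bool → Fin d → MvPolynomial ((Fin K × Bool) × Fin d) (ZMod p) :=
    fun u i => X (u, i)
  let P : MvPolynomial ((Fin K × Bool) × Fin d) (ZMod p) :=
    lastRowDet ρ (fun i => x (i.1.elim B e, i.2)) (x (A, false)) *
        lastRowDet ρ (fun i => x (i.1.elim C e, i.2)) (x (A, true)) -
      lastRowDet ρ (fun i => x (i.1.elim B e, i.2)) (x (A, true)) *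
        lastRowDet ρ (fun i => x (i.1.elim C e, i.2)) (x (A, false))
  have hmap : ∀ {R : Type} [CommRing R] [Algebra (ZMod p) R] (c : Fin K × Bool → Fin d → R),
      aeval (fun y : (Fin K × Bool) × Fin d => c y.1 y.2) P =
      lastRowDet ρ (fun i => c (i.1.elim B e, i.2)) (c (A, false)) *
        lastRowDet ρ (fun i => c (i.1.elim C e, i.2)) (c (A, true)) -
      lastRowDet ρ (fun i => c (i.1.elim B e, i.2)) (c (A, true)) *
        lastRowDet ρ (fun i => c (i.1.elim C e, i.2)) (c (A, false)) := by
    intro R _ _ c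
    have h1 : ∀ (u : Option (Fin s) × Bool → Fin K × Bool) w, aeval (fun y : (Fin K × Bool) × Fin d => c y.1 y.2)
        (lastRowDet ρ (fun i => x (u i)) (x w)) =
        lastRowDet ρ (fun i => c (u i)) (c w) := by
      intro u w
      have := map_lastRowDet (aeval (R := ZMod p)
        (fun y : (Fin K × Bool) × Fin d => c y.1 y.2)).toRingHom ρ
        (fun i : Option (Fin s) × Bool => x (u i)) (x w)
      simpa [x] using this
    simp only [P, map_sub, map_mul, h1]
  have hP : P ≠ 0 := by
    intro h
    -- A test instance of basis vectors: B shares its demand vector with A, C shares its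
    -- side-information vector with A, and the other vectors of B and C are the remaining basis
    -- vector. The first product is then `(-1) * (-1)`, and the second vanishes by a repeated row.
    let τ : Fin K × Bool → Option (Option (Fin s) × Bool) := fun u =>
      if hu : u.1.val < s then some (some ⟨u.1.val, hu⟩, u.2)
      else if u.1.val = s then some (none, u.2)
      else if u.1.val = s + 1 then (if u.2 then some (none, true) else none)
      else (if u.2 then none else some (none, false))
    have hτe : ∀ i b, τ (e i, b) = some (some i, b) := fun i b => by simp [τ, e]
    have hτA : ∀ b, τ (A, b) = some (none, b) := fun b => by simp [τ, A]
    have hτB : ∀ b, τ (B, b) = if b then some (none, true) else none := fun b => by simp [τ, B]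
    have hτC : ∀ b, τ (C, b) = if b then none else some (none, false) := fun b => by simp [τ, C]
    have h1 := hmap (R := ZMod p) (fun u => Pi.single (ρ (τ u)) 1)
    rw [h, map_zero] at h1
    rw [lastRowDet_single_perm ρ _ _ (Equiv.swap none (some (none, false))) (by simp [hτA]) ?_,
      lastRowDet_single_perm ρ _ _ (Equiv.swap none (some (none, true))) (by simp [hτA]) ?_,
      Equiv.Perm.sign_swap (by simp), Equiv.Perm.sign_swap (by simp)] at h1
    · have h2 : lastRowDet ρ
          (fun i : Option (Fin s) × Bool =>
            (Pi.single (ρ (τ (i.1.elim B e, i.2))) 1 : Fin d → ZMod p))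
          (Pi.single (ρ (τ (A, true))) 1) = 0 := by
        have := lastRowDet_apply_self ρ (fun i : Option (Fin s) × Bool =>
            (Pi.single (ρ (τ (i.1.elim B e, i.2))) 1 : Fin d → ZMod p)) (none, true)
        simpa [hτA, hτB] using this
      rw [h2] at h1
      simp at h1
    · rintro ⟨_ | i, _ | _⟩
      · simp [hτC, Equiv.swap_apply_of_ne_of_ne]
      · simp [hτC]
      · simp [hτe, Equiv.swap_apply_of_ne_of_ne]
      · simp [hτe, Equiv.swap_apply_of_ne_of_ne]
    · rintro ⟨_ | i, _ | _⟩
      · simp [hτB]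
      · simp [hτB, Equiv.swap_apply_of_ne_of_ne]
      · simp [hτe, Equiv.swap_apply_of_ne_of_ne]
      · simp [hτe, Equiv.swap_apply_of_ne_of_ne]
  refine (generically_aeval_coord_ne_zero P hP).mono (Eventually.of_forall fun n Λ hΛ => ?_)
  refine Λ.half_le_optimalCost hd e A B C ρ ?_
  rw [← hmap Λ.vec]
  exact hΛ

end LCBC

/-! ### Completing independent families, and the choice of exponent bound -/

theorem LinearIndependent.exists_span_union_eq_top {k V ι : Type*} [Field k] [AddCommGroup V]
    [Module k V] [Module.Finite k V] [Fintype ι] {a : ι → V} (ha : LinearIndependent k a) {n : ℕ}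
    (hn : Module.finrank k V = n) :
    ∃ c : Fin (n - Fintype.card ι) → V, Submodule.span k (Set.range a ∪ Set.range c) = ⊤ := by
  obtain ⟨W, hW⟩ := Submodule.exists_isCompl (Submodule.span k (Set.range a))
  have h1 := Submodule.finrank_add_eq_of_isCompl hW
  rw [finrank_span_eq_card ha, hn] at h1
  let b := Module.finBasisOfFinrankEq k W (n := n - Fintype.card ι) (by omega)
  refine ⟨fun i => b i, ?_⟩
  have h2 : Submodule.span k (Set.range fun i => (b i : V)) = W := by
    have := congrArg (Submodule.map W.subtype) b.span_eq
    rw [Submodule.map_span, Submodule.map_top, Submodule.range_subtype, ← Set.range_comp] at this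
    exact this
  rw [Submodule.span_union, h2, hW.sup_eq_top]

theorem add_one_pow_sub_pow_ge (N τ : ℕ) (hτ : 2 ≤ τ) : N ^ τ + (N + 1) ≤ (N + 1) ^ τ := by
  obtain ⟨k, rfl⟩ : ∃ k, τ = k + 1 := ⟨τ - 1, by omega⟩
  have h1 : N ^ k ≤ (N + 1) ^ k := Nat.pow_le_pow_left (by omega) k
  have h2 : N + 1 ≤ (N + 1) ^ k := Nat.le_self_pow (by omega) _
  rw [pow_succ, pow_succ, mul_add, mul_one]
  exact Nat.add_le_add (Nat.mul_le_mul_right _ h1) h2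

/-- Exponent bounds `N` for which `2 N ^ τ` is asymptotic to `n`. -/
theorem exists_exponent_bound (τ : ℕ) (hτ : 1 ≤ τ) : ∃ N : ℕ → ℕ, Tendsto N atTop atTop ∧
    (∀ᶠ n in atTop, 2 * (N n + 1) ^ τ ≤ n) ∧
    Tendsto (fun n => (2 * (N n : ℝ) ^ τ) / n) atTop (𝓝 1) := by
  -- The final choice is `N = M - 1`: the lost unit gives `2 * (N + 1) ^ τ ≤ n`, while maximality of
  -- `M` gives `n < 2 * (N + 2) ^ τ`.
  let M : ℕ → ℕ := fun n => Nat.findGreatest (fun M => 2 * M ^ τ ≤ n) n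
  have hM1 : ∀ n, 2 * (M n) ^ τ ≤ n := fun n =>
    Nat.findGreatest_spec (P := fun M => 2 * M ^ τ ≤ n) (m := 0) (Nat.zero_le _)
      (by simp [Nat.pos_iff_ne_zero.1 hτ])
  have hM2 : ∀ n, n < 2 * (M n + 1) ^ τ := by
    intro n
    by_contra! h
    have h1 : M n + 1 ≤ (M n + 1) ^ τ := Nat.le_self_pow (by omega) _
    have h2 : M n + 1 ≤ M n :=
      Nat.le_findGreatest (P := fun M => 2 * M ^ τ ≤ n) (by omega) h
    omega
  have hM3 : Tendsto M atTop atTop := by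
    refine tendsto_atTop.2 fun b => ?_
    filter_upwards [eventually_ge_atTop (2 * b ^ τ)] with n hn
    have h1 : b ≤ b ^ τ := Nat.le_self_pow (by omega) _
    exact Nat.le_findGreatest (P := fun M => 2 * M ^ τ ≤ n) (by omega) hn
  have hN : Tendsto (fun n => M n - 1) atTop atTop := (tendsto_sub_atTop_nat 1).comp hM3
  have hM4 : ∀ᶠ n in atTop, 1 ≤ M n := hM3.eventually_ge_atTop 1
  refine ⟨fun n => M n - 1, hN, ?_, ?_⟩
  · filter_upwards [hM4] with n hn
    rw [Nat.sub_add_cancel hn]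
    exact hM1 n
  · have h1 : Tendsto (fun n => (((M n - 1 : ℕ) : ℝ) / ((M n - 1 : ℕ) + 2)) ^ τ) atTop (𝓝 1) := by
      have := ((tendsto_natCast_div_add_atTop (2 : ℝ)).comp hN).pow τ
      simpa using this
    refine tendsto_of_tendsto_of_tendsto_of_le_of_le' h1 tendsto_const_nhds ?_ ?_
    · filter_upwards [hM4, eventually_gt_atTop 0] with n hn hn0
      have h2 : (n : ℝ) ≤ 2 * (((M n - 1 : ℕ) : ℝ) + 2) ^ τ := by
        have h3 : M n + 1 = (M n - 1) + 2 := by omega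
        have h4 := (hM2 n).le
        rw [h3] at h4
        exact_mod_cast h4
      have hn0' : (0 : ℝ) < n := by exact_mod_cast hn0
      rw [div_pow, div_le_div_iff₀ (by positivity) hn0']
      have h5 : (0 : ℝ) ≤ ((M n - 1 : ℕ) : ℝ) ^ τ := by positivity
      nlinarith
    · filter_upwards [eventually_gt_atTop 0] with n hn0
      have hn0' : (0 : ℝ) < n := by exact_mod_cast hn0
      rw [div_le_one hn0']
      have h2 : 2 * (M n - 1) ^ τ ≤ n :=
        (Nat.mul_le_mul_left _ (Nat.pow_le_pow_left (Nat.sub_le _ _) τ)).trans (hM1 n)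
      exact_mod_cast h2

/-! ### Interference alignment over the prime field -/

namespace LCBC

open MvPolynomial

section Alignment

variable {K d p : ℕ} [Fact p.Prime]

/-- The coordinates of a combination, with coefficients `r`, of a user's demand and side-information
vectors with coordinates `x`. -/
def mix {R : Type} [CommRing R] (x : (Fin K × Bool) × Fin d → R) (r : (Fin K × Bool) × Bool → R)
    (y : (Fin K × Bool) × Fin d) : R :=
  r (y.1, true) * x ((y.1.1, true), y.2) + r (y.1, false) * x ((y.1.1, false), y.2)

/-- The polynomial whose nonvanishing says that the coefficients `c` are not those of a linear
relation between the aligned monomials seen by user `k`. -/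
def relationPoly (N : ℕ) (k : Fin K)
    (c : Bool × ((Fin K × Bool) × Fin d → Fin N) → ZMod p) :
    MvPolynomial (((Fin K × Bool) × Fin d) ⊕ ((Fin K × Bool) × Bool)) (ZMod p) :=
  ∑ i, C (c i) * (X (Sum.inr ((k, i.1), true)) *
    ∏ y, mix (fun z => X (Sum.inl z)) (fun z => X (Sum.inr z)) y ^ (i.2 y : ℕ))

theorem aeval_relationPoly {R : Type} [CommRing R] [Algebra (ZMod p) R] (N : ℕ) (k : Fin K)
    (c : Bool × ((Fin K × Bool) × Fin d → Fin N) → ZMod p)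
    (x : (Fin K × Bool) × Fin d → R) (r : (Fin K × Bool) × Bool → R) :
    aeval (Sum.elim x r) (relationPoly N k c) =
      ∑ i, c i • (r ((k, i.1), true) * ∏ y, mix x r y ^ (i.2 y : ℕ)) := by
  simp [relationPoly, mix, Algebra.smul_def, map_sum, map_prod]

theorem relationPoly_ne_zero (N : ℕ) (k : Fin K)
    (c : Bool × ((Fin K × Bool) × Fin d → Fin N) → ZMod p) (hc : c ≠ 0) :
    relationPoly N k c ≠ 0 := by
  classical
  intro h
  obtain ⟨⟨j₀, m₀⟩, h0⟩ := Function.ne_iff.1 hc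
  -- Specialization turning every `mix` into its own variable, with prefactor `1` for `j₀` and `0`
  -- for the other index; only the terms with `j₀` survive, and their monomials are distinct.
  let x : (Fin K × Bool) × Fin d → MvPolynomial ((Fin K × Bool) × Fin d) (ZMod p) :=
    fun y => X ((y.1.1, y.1.2 == j₀), y.2)
  let r : (Fin K × Bool) × Bool → MvPolynomial ((Fin K × Bool) × Fin d) (ZMod p) :=
    fun y => if (y.1.2 == j₀) = y.2 then 1 else 0
  have hmix : ∀ y, mix x r y = X y := by
    rintro ⟨⟨k, j⟩, i⟩
    cases j <;> cases j₀ <;> simp [mix, x, r]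
  have h1 := aeval_relationPoly N k c x r
  rw [h, map_zero] at h1
  have h2 := congrArg
    (coeff (Finsupp.equivFunOnFinite.symm fun y => (m₀ y : ℕ))) h1
  have h3 : ∀ m : (Fin K × Bool) × Fin d → Fin N,
      (∏ y, (X y : MvPolynomial ((Fin K × Bool) × Fin d) (ZMod p)) ^ (m y : ℕ)) =
      monomial (Finsupp.equivFunOnFinite.symm fun y => (m y : ℕ)) 1 := by
    intro m
    rw [monomial_eq, C_1, one_mul, Finsupp.prod_fintype _ _ (by simp)]
    rfl
  have h4 : ∀ m : (Fin K × Bool) × Fin d → Fin N,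
      (Finsupp.equivFunOnFinite.symm (fun y => (m y : ℕ)) =
        Finsupp.equivFunOnFinite.symm fun y => (m₀ y : ℕ)) ↔ m = m₀ := by
    intro m
    rw [EmbeddingLike.apply_eq_iff_eq]
    refine ⟨fun h => funext fun y => Fin.ext (congrFun h y), fun h => by rw [h]⟩
  simp only [hmix, h3, coeff_zero, coeff_sum, coeff_smul, Fintype.sum_prod_type] at h2
  rw [Fintype.sum_eq_single j₀, Fintype.sum_eq_single m₀] at h2
  · simp [r] at h2
    exact h0 h2.symm
  · intro m hm
    simp [r, coeff_monomial, h4, hm]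
  · intro j hj
    simp [r, hj]

theorem totalDegree_relationPoly_le (N : ℕ) (k : Fin K)
    (c : Bool × ((Fin K × Bool) × Fin d → Fin N) → ZMod p) :
    (relationPoly N k c).totalDegree ≤ 1 + Fintype.card ((Fin K × Bool) × Fin d) * (N * 2) := by
  have hmix : ∀ y, (mix (fun z => (X (Sum.inl z) :
      MvPolynomial (((Fin K × Bool) × Fin d) ⊕ ((Fin K × Bool) × Bool)) (ZMod p)))
      (fun z => X (Sum.inr z)) y).totalDegree ≤ 2 := by
    intro y
    refine (totalDegree_add _ _).trans (max_le ?_ ?_) <;>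
    · refine (totalDegree_mul _ _).trans ?_
      rw [totalDegree_X, totalDegree_X]
  refine totalDegree_finsetSum_le fun i _ => ?_
  refine (totalDegree_mul _ _).trans ?_
  rw [totalDegree_C, zero_add]
  refine (totalDegree_mul _ _).trans ?_
  rw [totalDegree_X]
  refine Nat.add_le_add_left ?_ 1
  refine (totalDegree_finsetProd _ _).trans ?_
  rw [← Finset.card_univ, ← smul_eq_mul (a := Finset.card _)]
  refine Finset.sum_le_card_nsmul _ _ _ fun y _ => ?_
  refine (totalDegree_pow _ _).trans ?_
  exact Nat.mul_le_mul (i.2 y).is_lt.le (hmix y)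

variable {F : Type} [Field F] [Finite F] [Algebra (ZMod p) F]

/-- The instances for which some choice of coefficients makes the aligned monomials seen by each user
linearly independent over the prime field. -/
def Alignable (p N : ℕ) [Fact p.Prime] [Algebra (ZMod p) F]
    (Λ : LCBC F K d (fun _ => 1) (fun _ => 1)) : Prop :=
  ∃ r : (Fin K × Bool) × Bool → F, ∀ k, LinearIndependent (ZMod p)
    fun i : Bool × ((Fin K × Bool) × Fin d → Fin N) =>
      r ((k, i.1), true) * ∏ y, mix Λ.coord r y ^ (i.2 y : ℕ)

/-- Union bound over the at most `K * p ^ (2 * N ^ τ)` possible nontrivial relations, `τ` being the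
number of coordinates of an instance. -/
theorem one_sub_le_prob_alignable (N : ℕ) :
    1 - ((K * p ^ (2 * N ^ Fintype.card ((Fin K × Bool) × Fin d)) : ℕ) *
      (1 + Fintype.card ((Fin K × Bool) × Fin d) * (N * 2) : ℕ) : ℝ) / Nat.card F ≤
    prob F K d _ _ {Λ | Λ.Alignable p N} := by
  classical
  have : NeZero p := ⟨(Fact.out : p.Prime).ne_zero⟩
  let S : Finset (MvPolynomial (((Fin K × Bool) × Fin d) ⊕ ((Fin K × Bool) × Bool)) (ZMod p)) :=
    (Finset.univ.filter fun i : Fin K × (Bool × ((Fin K × Bool) × Fin d → Fin N) → ZMod p) =>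
      i.2 ≠ 0).image fun i => relationPoly N i.1 i.2
  have hS : S.card ≤ K * p ^ (2 * N ^ Fintype.card ((Fin K × Bool) × Fin d)) := by
    refine Finset.card_image_le.trans ((Finset.card_filter_le _ _).trans_eq ?_)
    rw [Finset.card_univ, Fintype.card_prod, Fintype.card_fun, Fintype.card_prod, Fintype.card_fun,
      Fintype.card_fin, Fintype.card_fin, ZMod.card, Fintype.card_bool]
  have h := one_sub_le_prob_exists_aeval_ne_zero (F := F) S
    (1 + Fintype.card ((Fin K × Bool) × Fin d) * (N * 2)) ?_ ?_
  · refine le_trans ?_ (h.trans (prob_mono ?_))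
    · gcongr
    · rintro Λ ⟨r, hr⟩
      refine ⟨r, fun k => Fintype.linearIndependent_iff.2 fun c hc => ?_⟩
      by_contra hne
      have hc0 : c ≠ 0 := fun h0 => hne fun i => congrFun h0 i
      have hmem : relationPoly N k c ∈ S :=
        Finset.mem_image.2 ⟨(k, c), Finset.mem_filter.2 ⟨Finset.mem_univ _, hc0⟩, rfl⟩
      exact hr _ hmem ((aeval_relationPoly N k c _ r).trans hc)
  · intro P hP
    obtain ⟨i, hi, rfl⟩ := Finset.mem_image.1 hP
    exact relationPoly_ne_zero _ _ _ (Finset.mem_filter.1 hi).2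
  · intro P hP
    obtain ⟨i, hi, rfl⟩ := Finset.mem_image.1 hP
    exact totalDegree_relationPoly_le _ _ _

/-- The first summand counts the aligned symbols shared by all users; the second counts, for each
user, the functionals of its demand needed to complete its independent family to a spanning set of
`F`. -/
theorem Alignable.optimalCost_le {N n : ℕ} (hF : Nat.card F = p ^ n)
    {Λ : LCBC F K d (fun _ => 1) (fun _ => 1)} (hΛ : Λ.Alignable p N) :
    Λ.optimalCost ≤ ((d * (N + 1) ^ Fintype.card ((Fin K × Bool) × Fin d) +
      K * (n - 2 * N ^ Fintype.card ((Fin K × Bool) × Fin d)) : ℕ) : ℝ) / n := by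
  classical
  have hp := (Fact.out : p.Prime)
  have : NeZero p := ⟨hp.ne_zero⟩
  obtain ⟨r, hr⟩ := hΛ
  have hrank : Module.finrank (ZMod p) F = n := by
    have h1 := Module.natCard_eq_pow_finrank (K := ZMod p) (V := F)
    rw [hF, Nat.card_zmod] at h1
    exact (Nat.pow_right_injective hp.two_le h1).symm
  obtain ⟨lam, hlam⟩ : ∃ lam : F →ₗ[ZMod p] ZMod p, lam ≠ 0 := exists_ne 0
  choose c hc using fun k => (hr k).exists_span_union_eq_top hrank
  set t := mix Λ.coord r with ht
  let T := (Fin K × Bool) × Fin d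
  let mon : (T → ℕ) → F := fun m => ∏ y, t y ^ m y
  let S := (Fin d × (T → Fin (N + 1)) → ZMod p) ×
    (Fin K × Fin (n - Fintype.card (Bool × (T → Fin N))) → ZMod p)
  let enc : (Fin d → F) →+ S :=
    { toFun := fun z => (fun i => lam (mon (fun y => i.2 y) * z i.1),
        fun i => lam (c i.1 i.2 * (z ⬝ᵥ Λ.vec (i.1, true))))
      map_zero' := by ext <;> simp
      map_add' := fun z z' => by
        refine Prod.ext (funext fun i => ?_) (funext fun i => ?_)
        · change lam _ = lam _ + lam _
          rw [← map_add, ← mul_add]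
          rfl
        · change lam (c i.1 i.2 * ((z + z') ⬝ᵥ _)) = lam _ + lam _
          rw [add_dotProduct, mul_add, map_add] }
  have hcost := Λ.optimalCost_le_logb enc ?_
  · refine hcost.trans_eq ?_
    have hS : Nat.card S = p ^ (d * (N + 1) ^ Fintype.card ((Fin K × Bool) × Fin d) +
        K * (n - 2 * N ^ Fintype.card ((Fin K × Bool) × Fin d))) := by
      rw [Nat.card_eq_fintype_card, pow_add]
      simp only [S, T, Fintype.card_prod, Fintype.card_fun, Fintype.card_fin, ZMod.card,
        Fintype.card_bool]
    have hlog : Real.log p ≠ 0 := (Real.log_pos (by exact_mod_cast hp.one_lt)).ne'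
    rw [hS, hF, Real.logb, Nat.cast_pow, Nat.cast_pow, Real.log_pow, Real.log_pow,
      mul_div_mul_right _ _ hlog]
  · intro k z hz hz'
    have hz1 : ∀ i (m : T → Fin (N + 1)), lam (mon (fun y => m y) * z i) = 0 :=
      fun i m => congrFun (congrArg Prod.fst hz) (i, m)
    have hz2 : ∀ l, lam (c k l * (z ⬝ᵥ Λ.vec (k, true))) = 0 :=
      fun l => congrFun (congrArg Prod.snd hz) (k, l)
    set D := z ⬝ᵥ Λ.vec (k, true) with hD
    have hmon : ∀ (m : T → Fin N) y, mon (fun y => m y) * t y =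
        mon (fun y' => ((⟨m y' + if y' = y then 1 else 0, by
          have := (m y').is_lt; split_ifs <;> omega⟩ : Fin (N + 1)) : ℕ)) := by
      intro m y
      simp only [mon, pow_add, Finset.prod_mul_distrib, pow_ite, pow_one, pow_zero,
        Finset.prod_ite_eq', Finset.mem_univ, if_true]
    have hr1 : ∀ i : Bool × (T → Fin N),
        lam ((r ((k, i.1), true) * ∏ y, t y ^ (i.2 y : ℕ)) * D) = 0 := by
      rintro ⟨j, m⟩
      -- As the side information of `z` vanishes, its multiple can be added freely, which turns the
      -- scaled demand into a combination with coefficients `t`.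
      have h1 : r ((k, j), true) * D = ∑ i, t ((k, j), i) * z i := by
        have h2 : r ((k, j), true) * D =
            r ((k, j), true) * D + r ((k, j), false) * (z ⬝ᵥ Λ.vec (k, false)) := by
          rw [hz', mul_zero, add_zero]
        rw [h2, hD]
        simp only [dotProduct, Finset.mul_sum, ← Finset.sum_add_distrib, ht, mix, coord]
        exact Finset.sum_congr rfl fun i _ => by ring
      have h3 : (r ((k, j), true) * ∏ y, t y ^ (m y : ℕ)) * D =
          ∑ i, (mon (fun y => m y) * t ((k, j), i)) * z i := by
        rw [mul_right_comm, h1, Finset.sum_mul]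
        exact Finset.sum_congr rfl fun i _ => by simp only [mon]; ring
      rw [h3, map_sum]
      exact Finset.sum_eq_zero fun i _ => by rw [hmon, hz1]
    have hall : ∀ w : F, lam (w * D) = 0 := by
      intro w
      have hle : Submodule.span (ZMod p) (Set.range (fun i : Bool × (T → Fin N) =>
          r ((k, i.1), true) * ∏ y, t y ^ (i.2 y : ℕ)) ∪ Set.range (c k)) ≤
          (lam ∘ₗ LinearMap.mulRight (ZMod p) D).ker := by
        rw [Submodule.span_le]
        rintro _ (⟨i, rfl⟩ | ⟨i, rfl⟩)
        · exact hr1 i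
        · exact hz2 i
      rw [hc k] at hle
      exact hle (Submodule.mem_top (x := w))
    by_contra hne
    refine hlam (LinearMap.ext fun w => ?_)
    have := hall (w / D)
    rwa [div_mul_cancel₀ _ hne] at this

theorem generically_optimalCost_le (hK : 1 ≤ K) (hd : 1 ≤ d) {ε : ℝ} (hε : 0 < ε) :
    Generically (p := p) fun n => {Λ : LCBC (GaloisField p n) K d _ _ |
      Λ.optimalCost ≤ d / 2 + ε} := by
  have hp := (Fact.out : p.Prime)
  set τ := Fintype.card ((Fin K × Bool) × Fin d) with hτ
  have hτ2 : 2 ≤ τ := by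
    simp only [hτ, Fintype.card_prod, Fintype.card_fin, Fintype.card_bool]
    nlinarith
  obtain ⟨N, hN, hN1, hN2⟩ := exists_exponent_bound τ (by omega)
  have halign : Generically (p := p) fun n =>
      {Λ : LCBC (GaloisField p n) K d _ _ | Λ.Alignable p (N n)} := by
    have hlim0 : Tendsto (fun N : ℕ => (K : ℝ) * ((1 + τ * (N * 2) : ℝ) / 2 ^ N)) atTop (𝓝 0) := by
      have h1 : Tendsto (fun N : ℕ => (1 : ℝ) / 2 ^ N) atTop (𝓝 0) := by
        simpa using tendsto_pow_const_div_const_pow_of_one_lt 0 (one_lt_two : (1 : ℝ) < 2)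
      have h2 : Tendsto (fun N : ℕ => (N : ℝ) / 2 ^ N) atTop (𝓝 0) := by
        simpa using tendsto_pow_const_div_const_pow_of_one_lt 1 (one_lt_two : (1 : ℝ) < 2)
      have h3 := (h1.add (h2.const_mul (τ * 2 : ℝ))).const_mul (K : ℝ)
      simp only [mul_zero, add_zero] at h3
      refine h3.congr fun N => ?_
      ring
    have hlim := (tendsto_const_nhds (x := (1 : ℝ))).sub (hlim0.comp hN)
    rw [sub_zero] at hlim
    refine tendsto_of_tendsto_of_tendsto_of_le_of_le' hlim tendsto_const_nhds ?_
      (Eventually.of_forall fun _ => prob_le_one _)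
    filter_upwards [hN1, eventually_ne_atTop 0] with n hn hn0
    refine le_trans ?_ (one_sub_le_prob_alignable (p := p) (N n))
    rw [GaloisField.card p n hn0, ← hτ]
    refine sub_le_sub_left ?_ 1
    -- The gap between `2 * (N + 1) ^ τ` and `2 * N ^ τ` exceeds `N`, so the failure probability is
    -- exponentially small in `N` against a linear degree.
    have hpow : p ^ (2 * N n ^ τ) * 2 ^ N n ≤ p ^ n := by
      have h1 := add_one_pow_sub_pow_ge (N n) τ hτ2
      calc p ^ (2 * N n ^ τ) * 2 ^ N n ≤ p ^ (2 * N n ^ τ) * p ^ N n :=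
            Nat.mul_le_mul_left _ (Nat.pow_le_pow_left hp.two_le _)
        _ = p ^ (2 * N n ^ τ + N n) := (pow_add _ _ _).symm
        _ ≤ p ^ n := Nat.pow_le_pow_right hp.pos (by omega)
    have hpow' : (p : ℝ) ^ (2 * N n ^ τ) * 2 ^ N n ≤ (p : ℝ) ^ n := by exact_mod_cast hpow
    have hp0 : (0 : ℝ) < p := by exact_mod_cast hp.pos
    simp only [Function.comp_apply]
    push_cast
    rw [mul_div_assoc', div_le_div_iff₀ (by positivity) (by positivity)]
    calc _ = ((K : ℝ) * (1 + τ * (N n * 2))) * ((p : ℝ) ^ (2 * N n ^ τ) * 2 ^ N n) := by ring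
      _ ≤ ((K : ℝ) * (1 + τ * (N n * 2))) * (p : ℝ) ^ n := by gcongr
  refine halign.mono ?_
  have hlim : Tendsto (fun n => (K : ℝ) * (1 - (2 * (N n : ℝ) ^ τ) / n)) atTop (𝓝 0) := by
    simpa using (hN2.const_sub 1).const_mul (K : ℝ)
  filter_upwards [hN1, eventually_gt_atTop 0, hlim.eventually_lt_const hε] with n hn hn0 hlt Λ hΛ
  refine (Alignable.optimalCost_le (GaloisField.card p n hn0.ne') hΛ).trans ?_
  rw [← hτ]
  have hn0' : (0 : ℝ) < n := by exact_mod_cast hn0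
  have h1 : 2 * N n ^ τ ≤ n :=
    (Nat.mul_le_mul_left 2 (Nat.pow_le_pow_left (Nat.le_succ _) τ)).trans hn
  have h2 : (2 : ℝ) * (N n + 1) ^ τ ≤ n := by exact_mod_cast hn
  push_cast [Nat.cast_sub h1]
  rw [add_div]
  refine add_le_add ?_ ?_
  · rw [div_le_div_iff₀ hn0' two_pos]
    nlinarith [(Nat.cast_nonneg d : (0 : ℝ) ≤ d)]
  · refine le_of_eq_of_le ?_ hlt.le
    field_simp

end Alignment

end LCBC

/-! ### Boundary cases and passage to generic costs -/

namespace LCBC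

variable {F : Type} [Field F] [Finite F] {K d : ℕ}

theorem logb_natCard_fun (ι : Type) [Fintype ι] :
    Real.logb (Nat.card F) (Nat.card (ι → F)) = Fintype.card ι := by
  have hq : 1 < (Nat.card F : ℝ) := by exact_mod_cast Finite.one_lt_card
  rw [Nat.card_fun, Nat.cast_pow, Real.logb_pow, Real.logb_self_eq_one hq, mul_one,
    Nat.card_eq_fintype_card]

theorem optimalCost_le_card_users (Λ : LCBC F K d (fun _ => 1) (fun _ => 1)) :
    Λ.optimalCost ≤ K := by
  let enc : (Fin d → F) →+ (Fin K → F) :=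
    { toFun := fun z k => z ⬝ᵥ Λ.vec (k, true)
      map_zero' := by ext; simp
      map_add' := fun z z' => by ext; simp [add_dotProduct] }
  have h := Λ.optimalCost_le_logb enc fun k z hz _ => congrFun hz k
  rwa [logb_natCard_fun, Fintype.card_fin] at h

theorem optimalCost_le_zero (Λ : LCBC F K 1 (fun _ => 1) (fun _ => 1))
    (h : ∀ k, Λ.vec (k, false) ≠ 0) : Λ.optimalCost ≤ 0 := by
  have h1 := Λ.optimalCost_le_logb (0 : (Fin 1 → F) →+ PUnit) fun k z _ hz => by
    have h2 : Λ.vec (k, false) 0 ≠ 0 := fun h0 =>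
      h k (funext fun i => by rw [Subsingleton.elim i 0]; exact h0)
    have h3 : z 0 = 0 := by
      simpa [dotProduct, h2] using hz
    simp [dotProduct, h3]
  simpa using h1

/-- If the `2K` demand and side-information vectors are dependent, but become independent when any
single demand vector is dropped, one user's transmission can be saved. -/
theorem optimalCost_le_card_users_sub_one (Λ : LCBC F K d (fun _ => 1) (fun _ => 1)) (hK : 1 ≤ K)
    (hd : d < 2 * K)
    (h : ∀ k, LinearIndependent F fun u : {u : Fin K × Bool // u ≠ (k, true)} => Λ.vec u) :
    Λ.optimalCost ≤ K - 1 := by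
  classical
  have hdep : ¬ LinearIndependent F Λ.vec := by
    intro hli
    have := hli.fintype_card_le_finrank
    simp at this
    omega
  obtain ⟨g, hg, u₀, hu₀⟩ := Fintype.not_linearIndependent_iff.1 hdep
  -- A relation missing one demand vector would be trivial by `h`.
  have hgk : ∀ k, g (k, true) ≠ 0 := by
    intro k hk
    have h1 : ∑ u : {u : Fin K × Bool // u ≠ (k, true)}, g u • Λ.vec u = 0 := by
      rw [← hg, ← Fintype.sum_subtype_add_sum_subtype (fun u => u ≠ (k, true)), left_eq_add]
      refine Finset.sum_eq_zero fun u _ => ?_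
      rw [not_not.1 u.2, hk, zero_smul]
    have h2 := Fintype.linearIndependent_iff.1 (h k) (fun u => g u) h1
    exact hu₀ (if hu : u₀ = (k, true) then hu ▸ hk else h2 ⟨u₀, hu⟩)
  -- Each user can decode from its part `w k` of the relation. The parts sum to zero, so the one for
  -- `k₀` need not be sent.
  let w : Fin K → Fin d → F :=
    fun k => g (k, true) • Λ.vec (k, true) + g (k, false) • Λ.vec (k, false)
  have hw : ∑ k, w k = 0 := by
    rw [← hg, Fintype.sum_prod_type]
    simp [w]
  let k₀ : Fin K := ⟨0, hK⟩
  let enc : (Fin d → F) →+ ({k : Fin K // k ≠ k₀} → F) :=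
    { toFun := fun z k => z ⬝ᵥ w k
      map_zero' := by ext; simp
      map_add' := fun z z' => by ext; simp [add_dotProduct] }
  have hle := Λ.optimalCost_le_logb enc fun k z hz hz' => by
    have h1 : ∀ k, k ≠ k₀ → z ⬝ᵥ w k = 0 := fun k hk => congrFun hz ⟨k, hk⟩
    have h2 : z ⬝ᵥ w k = 0 := by
      by_cases hk : k = k₀
      · have h3 : ∑ k, z ⬝ᵥ w k = 0 := by rw [← dotProduct_sum, hw, dotProduct_zero]
        rw [Fintype.sum_eq_single k₀ h1] at h3
        rw [hk, h3]
      · exact h1 k hk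
    simp only [w, dotProduct_add, dotProduct_smul, hz', mul_zero, add_zero, smul_eq_mul] at h2
    exact (mul_eq_zero.1 h2).resolve_left (hgk k)
  rw [logb_natCard_fun, Fintype.card_subtype_compl, Fintype.card_subtype_eq, Fintype.card_fin,
    Nat.cast_sub hK, Nat.cast_one] at hle
  exact hle

variable {p : ℕ} [Fact p.Prime]

theorem isGenericOptimalCost_of_bounds {Δ : ℝ}
    (hle : ∀ ε : ℝ, 0 < ε → Generically (p := p) fun n =>
      {Λ : LCBC (GaloisField p n) K d _ _ | Λ.optimalCost ≤ Δ + ε})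
    (hge : Generically (p := p) fun n =>
      {Λ : LCBC (GaloisField p n) K d _ _ | Δ ≤ Λ.optimalCost}) :
    IsGenericOptimalCost p K d (fun _ => 1) (fun _ => 1) Δ := by
  intro ε hε
  refine ((hle (ε / 2) (half_pos hε)).inter hge).mono (Eventually.of_forall ?_)
  rintro n Λ ⟨h1, h2⟩
  simp only [Set.mem_ofPred_eq] at h1 h2 ⊢
  rw [abs_lt]
  constructor <;> linarith

theorem isGenericOptimalCost_of_le {Δ : ℝ}
    (hle : Generically (p := p) fun n =>
      {Λ : LCBC (GaloisField p n) K d _ _ | Λ.optimalCost ≤ Δ})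
    (hge : Generically (p := p) fun n =>
      {Λ : LCBC (GaloisField p n) K d _ _ | Δ ≤ Λ.optimalCost}) :
    IsGenericOptimalCost p K d (fun _ => 1) (fun _ => 1) Δ :=
  isGenericOptimalCost_of_bounds (fun _ hε => hle.mono
    (Eventually.of_forall fun _ _ hΛ => le_trans hΛ (le_add_of_nonneg_right hε.le))) hge

theorem generically_of_forall
    {E : ∀ n, Set (LCBC (GaloisField p n) K d (fun _ => 1) (fun _ => 1))}
    (h : ∀ n Λ, Λ ∈ E n) : Generically E :=
  (Generically.iInter (ι := Empty) (E := fun _ => E) (fun i => i.elim)).mono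
    (Eventually.of_forall fun n Λ _ => h n Λ)

theorem generically_natCast_le_optimalCost {t : ℕ} (htK : t ≤ K) (htd : 2 * t ≤ d) :
    Generically (p := p) fun n =>
      {Λ : LCBC (GaloisField p n) K d _ _ | (t : ℝ) ≤ Λ.optimalCost} := by
  refine (generically_linearIndependent (p := p)
    (fun u : Fin t × Bool => (Fin.castLE htK u.1, u.2)) ?_ ?_).mono
    (Eventually.of_forall fun n Λ hΛ => Λ.natCast_le_optimalCost (Fin.castLE htK) hΛ)
  · rintro ⟨i, b⟩ ⟨j, c⟩ h
    simpa using h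
  · simp only [Fintype.card_prod, Fintype.card_fin, Fintype.card_bool]
    omega

theorem isGenericOptimalCost_card_users (h : 2 * K ≤ d) :
    IsGenericOptimalCost p K d (fun _ => 1) (fun _ => 1) (K : ℝ) :=
  isGenericOptimalCost_of_le (generically_of_forall fun _ Λ => Λ.optimalCost_le_card_users)
    (generically_natCast_le_optimalCost le_rfl h)

theorem isGenericOptimalCost_zero :
    IsGenericOptimalCost p K 1 (fun _ => 1) (fun _ => 1) 0 := by
  refine isGenericOptimalCost_of_le ?_ (generically_of_forall fun _ Λ => Λ.optimalCost_nonneg)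
  refine (Generically.iInter fun k : Fin K => generically_linearIndependent (p := p) (d := 1)
    (fun _ : Unit => (k, false)) (fun _ _ _ => rfl) (by simp)).mono
    (Eventually.of_forall fun n Λ hΛ => Λ.optimalCost_le_zero fun k => ?_)
  exact LinearIndependent.ne_zero () (Set.mem_iInter.1 hΛ k)

theorem isGenericOptimalCost_card_users_sub_one (hK : 1 ≤ K) (hd : d = 2 * K - 1) :
    IsGenericOptimalCost p K d (fun _ => 1) (fun _ => 1) ((K : ℝ) - 1) := by
  refine isGenericOptimalCost_of_le ?_ ?_
  · refine (Generically.iInter fun k : Fin K => generically_linearIndependent (p := p) (d := d)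
      (fun u : {u : Fin K × Bool // u ≠ (k, true)} => (u : Fin K × Bool))
      Subtype.val_injective ?_).mono
      (Eventually.of_forall fun n Λ hΛ =>
        Λ.optimalCost_le_card_users_sub_one hK (by omega) fun k => Set.mem_iInter.1 hΛ k)
    rw [Fintype.card_subtype_compl, Fintype.card_subtype_eq]
    simp only [Fintype.card_prod, Fintype.card_fin, Fintype.card_bool]
    omega
  · have h := generically_natCast_le_optimalCost (p := p) (K := K) (d := d) (t := K - 1)
      (by omega) (by omega)
    rwa [Nat.cast_sub hK, Nat.cast_one] at h

end LCBC

end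

/-! ### The generic cost in all cases -/

theorem theorem3 (p : ℕ) [Fact p.Prime] (K d : ℕ) (hK : 1 ≤ K) :
    (Even d →
      (2 ≤ d → d ≤ 2 * K →
        LCBC.IsGenericOptimalCost p K d (fun _ => 1) (fun _ => 1) ((d : ℝ) / 2)) ∧
      (2 * K ≤ d →
        LCBC.IsGenericOptimalCost p K d (fun _ => 1) (fun _ => 1) (K : ℝ))) ∧
    (Odd d →
      (d = 1 →
        LCBC.IsGenericOptimalCost p K d (fun _ => 1) (fun _ => 1) 0) ∧
      (3 ≤ d → d < 2 * K - 1 →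
        LCBC.IsGenericOptimalCost p K d (fun _ => 1) (fun _ => 1) ((d : ℝ) / 2)) ∧
      (d = 2 * K - 1 →
        LCBC.IsGenericOptimalCost p K d (fun _ => 1) (fun _ => 1) ((K : ℝ) - 1)) ∧
      (2 * K - 1 < d →
        LCBC.IsGenericOptimalCost p K d (fun _ => 1) (fun _ => 1) (K : ℝ))) := by
  refine ⟨fun hd => ⟨fun h2 hdK => ?_, LCBC.isGenericOptimalCost_card_users⟩,
    fun hd => ⟨?_, fun h3 hdK => ?_, LCBC.isGenericOptimalCost_card_users_sub_one hK,
      fun h => LCBC.isGenericOptimalCost_card_users (by omega)⟩⟩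
  · obtain ⟨t, rfl⟩ := hd
    refine LCBC.isGenericOptimalCost_of_bounds
      (fun ε hε => LCBC.generically_optimalCost_le hK (by omega) hε) ?_
    have h := LCBC.generically_natCast_le_optimalCost (p := p) (K := K) (d := t + t) (t := t)
      (by omega) (by omega)
    have ht : ((t + t : ℕ) : ℝ) / 2 = t := by push_cast; ring
    rwa [ht]
  · rintro rfl
    exact LCBC.isGenericOptimalCost_zero
  · refine LCBC.isGenericOptimalCost_of_bounds
      (fun ε hε => LCBC.generically_optimalCost_le hK (by omega) hε) ?_
    obtain ⟨t, ht⟩ := hd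
    exact LCBC.generically_half_le_optimalCost (s := t - 1) (by omega) (by omega)
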